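/- For integers $n\ge 1$ and $k\ge 1$, the generalized Petersen graph $P(n,k)$ has vertex set $\{v_i,u_i : 0\le i\le n-1\}$ and edge set $\{v_iv_{i+1},\ v_iu_i,\ u_iu_{i+k} : 0\le i\le n-1\}$, subscripts taken modulo $n$. The domination number $\gamma(G)$ of a finite graph $G$ is the least cardinality of a set $S$ of vertices such that every vertex of $G$ lies in $S$ or is adjacent to a vertex of $S$. **Theorem 2.1.** For all integers $c\ge 3$ and $k\ge 3$, $$\gamma(P(ck,k)) \le \begin{cases} \frac{ck}{2}+\alpha, & \text{if } c\equiv 0 \pmod 4;\\ \frac{ck}{2}+\frac{k}{2}-1+\alpha, & \text{if } c\equiv 1,2 \pmod 4 \text{ and } k\equiv 0 \pmod 2;\\ \frac{ck-1}{2}+\frac{k+1}{2}+\alpha, & \text{if } c\equiv 1 \pmod 4 \text{ and } k\equiv 1 \pmod 2;\\ \frac{ck}{2}+\frac{k+1}{2}+\alpha, & \text{if } c\equiv 2 \pmod 4 \text{ and } k\equiv 1 \pmod 4;\\ \frac{ck}{2}+\frac{k-1}{2}+\alpha, & \text{if } c\equiv 2 \pmod 4 \text{ and } k\equiv 3 \pmod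 4;\\ \left\lfloor\frac{ck}{2}\right\rfloor+\left\lfloor\frac{k}{4}\right\rfloor+1+\alpha, & \text{if } c\equiv 3 \pmod 4 \text{ and } k\ne 4,8;\\ \frac{ck}{2}+\frac{k}{4}+\alpha, & \text{if } c\equiv 3 \pmod 4 \text{ and } k\in\{4,8\}, \end{cases}$$ where $\alpha=0$ if $k$ is odd and $\alpha=\left\lfloor\frac{c}{4}\right\rfloor$ if $k$ is even. -/

import Mathlib

/-- The generalized Petersen graph `P(n, k)`, on the vertices `v_i = Sum.inl i` and
`u_i = Sum.inr i` for `0 ≤ i ≤ n - 1`, with edges `v_i v_{i+1}`, `v_i u_i` and `u_i u_{i+k}`,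
subscripts taken modulo `n`. -/
def generalizedPetersen (n k : ℕ) : SimpleGraph (Fin n ⊕ Fin n) :=
  SimpleGraph.fromRel fun x y =>
    match x, y with
    | Sum.inl i, Sum.inl j => (j : ℕ) = ((i : ℕ) + 1) % n
    | Sum.inl i, Sum.inr j => i = j
    | Sum.inr i, Sum.inr j => (j : ℕ) = ((i : ℕ) + k) % n
    | Sum.inr _, Sum.inl _ => False

/-- `S` is a dominating set of `G`: every vertex is in `S` or adjacent to a vertex of `S`. -/
def IsDominatingSet {V : Type*} (G : SimpleGraph V) (S : Finset V) : Prop :=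
  ∀ v : V, v ∈ S ∨ ∃ w ∈ S, G.Adj v w

/-- The domination number `γ(G)` of a finite graph: the least cardinality of a dominating set.
The set of cardinalities is nonempty, as the set of all vertices dominates. -/
noncomputable def dominationNumber {V : Type*} [Finite V] (G : SimpleGraph V) : ℕ :=
  sInf {m : ℕ | ∃ S : Finset V, IsDominatingSet G S ∧ S.card = m}

/-- The correction term: `0` for odd `k` and `⌊c / 4⌋` for even `k`
(division of natural numbers rounds down). -/
def petersenAlpha (c k : ℕ) : ℕ :=
  if k % 2 = 1 then 0 else c / 4

/-! In `P(ck, k)` with `c ≥ 3` every vertex dominates four of the `2ck` vertices, so `ck/2` chosen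
vertices are best possible and require perfect domination. On the infinite array it is achieved by
the pattern of period four whose row `1, 0, 2, 0` shifts by one place per row: eight vertices in
each `4 × 4` block. For odd `k` a suitable direction of shift makes the end of each row fit the
start of the next; for even `k` the mismatch costs one extra vertex per four rows, which is the
source of `petersenAlpha`. If `4 ∤ c`, closing the columns costs extra vertices per four columns:
two for `c ≡ 1, 2`, one for `c ≡ 3` modulo 4. The repairs sit in finite tables, one for each pair of
residues modulo 4, extended by repeating a perfect `4 × 4` block. Covering is a local condition, so
two repetitions already exhibit every neighbourhood (`CoversArray.pump`) and a finite check
suffices. The weight is affine in each repetition count (`sum_pumpIndex`), so four block weights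
determine the bound. -/

/-!
A labelling `w` of a `c × k` array by `{0, 1, 2, 3}` encodes a set of vertices of `P(ck, k)`: the
cell in row `r` and column `j` stands for the index `i = j + k * r`, bit `0` of its label says
whether `v_i` is chosen and bit `1` whether `u_i` is chosen. The dominating sets below come from
finite tables whose first four rows and first four columns may be repeated any number of times.
-/

/-- The label selects the outer vertex of its cell. -/
abbrev SelectsOuter (a : ℕ) : Prop := a % 2 = 1

/-- The label selects the inner vertex of its cell. -/
abbrev SelectsInner (a : ℕ) : Prop := a / 2 % 2 = 1

/-- The number of vertices selected by a label. -/
def labelWeight (a : ℕ) : ℕ := a % 2 + a / 2 % 2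

/-- The cyclic successor of `i` in `{0, …, n - 1}`. -/
def cyclicSucc (n i : ℕ) : ℕ := if i + 1 < n then i + 1 else 0

/-- The cyclic predecessor of `i` in `{0, …, n - 1}`. -/
def cyclicPred (n i : ℕ) : ℕ := if i = 0 then n - 1 else i - 1

/-- Every outer and every inner vertex of the `c × k` array is selected by the labelling `w` or has
a selected neighbour in `P(ck, k)`. The outer cycle runs along the rows, from the end of each row
to the start of the next, and the inner cycles run along the columns. -/
def CoversArray (c k : ℕ) (w : ℕ → ℕ → ℕ) : Prop :=
  ∀ r < c, ∀ j < k,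
    (SelectsOuter (w r j) ∨ SelectsInner (w r j) ∨
      SelectsOuter (w (if j + 1 < k then r else cyclicSucc c r) (cyclicSucc k j)) ∨
      SelectsOuter (w (if j = 0 then cyclicPred c r else r) (cyclicPred k j))) ∧
    (SelectsOuter (w r j) ∨ SelectsInner (w r j) ∨
      SelectsInner (w (cyclicSucc c r) j) ∨ SelectsInner (w (cyclicPred c r) j))

instance (c k : ℕ) (w : ℕ → ℕ → ℕ) : Decidable (CoversArray c k w) := by
  unfold CoversArray
  infer_instance

/-! ### Array indices and the edges of the graph. -/

theorem cyclicSucc_lt {n i : ℕ} (h : i < n) : cyclicSucc n i < n := by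
  unfold cyclicSucc
  split_ifs <;> omega

theorem cyclicPred_lt {n i : ℕ} (h : i < n) : cyclicPred n i < n := by
  unfold cyclicPred
  split_ifs <;> omega

theorem cyclicSucc_cyclicPred {n i : ℕ} (h : i < n) : cyclicSucc n (cyclicPred n i) = i := by
  unfold cyclicSucc cyclicPred
  split_ifs <;> omega

/-- Moving down one row shifts the index by `k`. -/
theorem index_cyclicSucc_row {c k r j : ℕ} (hr : r < c) (hj : j < k) :
    j + k * cyclicSucc c r = (j + k * r + k) % (c * k) := by
  unfold cyclicSucc
  split_ifs with h
  · rw [Nat.mod_eq_of_lt]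
    · ring
    · nlinarith [Nat.mul_le_mul_right k (show r + 1 + 1 ≤ c by omega)]
  · obtain rfl : c = r + 1 := by omega
    rw [show j + k * r + k = j + (r + 1) * k by ring, Nat.add_mod_right, Nat.mod_eq_of_lt]
    · simp
    · nlinarith [Nat.zero_le (r * k)]

/-- Moving one step along the outer cycle shifts the index by `1`. -/
theorem index_cyclicSucc_column {c k r j : ℕ} (hr : r < c) (hj : j < k) :
    cyclicSucc k j + k * (if j + 1 < k then r else cyclicSucc c r)
      = (j + k * r + 1) % (c * k) := by
  by_cases h : j + 1 < k
  · rw [if_pos h, cyclicSucc, if_pos h, Nat.mod_eq_of_lt]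
    · ring
    · nlinarith [Nat.mul_le_mul_right k (show r + 1 ≤ c by omega)]
  -- Leaving the last column lands in column 0 one row down, and `j + 1 = k`.
  · have h0 := index_cyclicSucc_row (j := 0) hr (by omega : 0 < k)
    rw [if_neg h]
    simp only [cyclicSucc, if_neg h] at h0 ⊢
    rw [h0]
    congr 1
    omega

/-- `SimpleGraph.fromRel` discards loops, so the content is that the two endpoints differ; this is
where `2 ≤ n` enters. -/
theorem generalizedPetersen_adj_outer {n k : ℕ} (hn : 2 ≤ n) {i j : Fin n}
    (h : (j : ℕ) = ((i : ℕ) + 1) % n) :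
    (generalizedPetersen n k).Adj (Sum.inl i) (Sum.inl j) := by
  refine (SimpleGraph.fromRel_adj _ _ _).2 ⟨?_, Or.inl h⟩
  intro hij
  obtain rfl := Sum.inl.inj hij
  rcases Nat.lt_or_ge (i + 1) n with hi | hi
  · rw [Nat.mod_eq_of_lt hi] at h
    omega
  · rw [show (i : ℕ) + 1 = n by omega, Nat.mod_self] at h
    omega

theorem generalizedPetersen_adj_spoke {n k : ℕ} (i : Fin n) :
    (generalizedPetersen n k).Adj (Sum.inl i) (Sum.inr i) :=
  (SimpleGraph.fromRel_adj _ _ _).2 ⟨Sum.inl_ne_inr, Or.inl rfl⟩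

theorem generalizedPetersen_adj_inner {n k : ℕ} (hk : 0 < k) (hkn : k < n) {i j : Fin n}
    (h : (j : ℕ) = ((i : ℕ) + k) % n) :
    (generalizedPetersen n k).Adj (Sum.inr i) (Sum.inr j) := by
  refine (SimpleGraph.fromRel_adj _ _ _).2 ⟨?_, Or.inl h⟩
  intro hij
  obtain rfl := Sum.inr.inj hij
  rcases Nat.lt_or_ge (i + k) n with hi | hi
  · rw [Nat.mod_eq_of_lt hi] at h
    omega
  · rw [Nat.mod_eq_sub_mod hi, Nat.mod_eq_of_lt (by omega)] at h
    omega

/-- A covering labelling bounds the domination number by its total weight. -/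
theorem dominationNumber_le_of_coversArray {c k : ℕ} (hc : 2 ≤ c) (hk : 2 ≤ k)
    {w : ℕ → ℕ → ℕ} (hw : CoversArray c k w) :
    dominationNumber (generalizedPetersen (c * k) k) ≤
      ∑ r ∈ Finset.range c, ∑ j ∈ Finset.range k, labelWeight (w r j) := by
  classical
  have hkn : k < c * k := by nlinarith
  let e : Fin c × Fin k ≃ Fin (c * k) := finProdFinEquiv
  have he : ∀ p : Fin c × Fin k, ((e p : Fin (c * k)) : ℕ) = p.2 + k * p.1 := fun _ => rfl
  let A : Finset (Fin c × Fin k) := Finset.univ.filter fun p => SelectsOuter (w p.1 p.2)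
  let B : Finset (Fin c × Fin k) := Finset.univ.filter fun p => SelectsInner (w p.1 p.2)
  let S : Finset (Fin (c * k) ⊕ Fin (c * k)) := (A.map e.toEmbedding).disjSum (B.map e.toEmbedding)
  have memA : ∀ p : Fin c × Fin k, SelectsOuter (w p.1 p.2) → Sum.inl (e p) ∈ S := by
    intro p hp
    simpa [S, A] using hp
  have memB : ∀ p : Fin c × Fin k, SelectsInner (w p.1 p.2) → Sum.inr (e p) ∈ S := by
    intro p hp
    simpa [S, B] using hp
  have hS : IsDominatingSet (generalizedPetersen (c * k) k) S := by
    rintro (i | i) <;> obtain ⟨⟨⟨r, hr⟩, ⟨j, hj⟩⟩, rfl⟩ := e.surjective i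
    · rcases (hw r hr j hj).1 with h | h | h | h
      · exact Or.inl (memA _ h)
      · exact Or.inr ⟨_, memB _ h, generalizedPetersen_adj_spoke _⟩
      · have hr' : (if j + 1 < k then r else cyclicSucc c r) < c := by
          split_ifs
          exacts [hr, cyclicSucc_lt hr]
        exact Or.inr ⟨_, memA (⟨_, hr'⟩, ⟨_, cyclicSucc_lt hj⟩) h,
          generalizedPetersen_adj_outer (by omega) (index_cyclicSucc_column hr hj)⟩
      · have hr' : (if j = 0 then cyclicPred c r else r) < c := by
          split_ifs
          exacts [cyclicPred_lt hr, hr]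
        refine Or.inr ⟨_, memA (⟨_, hr'⟩, ⟨_, cyclicPred_lt hj⟩) h,
          (generalizedPetersen_adj_outer (by omega) ?_).symm⟩
        -- The edge is read from the predecessor, so the row change at the end of a row must be
        -- undone.
        have := index_cyclicSucc_column hr' (cyclicPred_lt hj)
        rw [cyclicSucc_cyclicPred hj] at this
        rw [he, he, ← this]
        by_cases h0 : j = 0
        · rw [if_pos h0, if_neg (by simp only [cyclicPred, if_pos h0]; omega),
            cyclicSucc_cyclicPred hr]
        · rw [if_neg h0, if_pos (by simp only [cyclicPred, if_neg h0]; omega)]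
    · rcases (hw r hr j hj).2 with h | h | h | h
      · exact Or.inr ⟨_, memA _ h, (generalizedPetersen_adj_spoke _).symm⟩
      · exact Or.inl (memB _ h)
      · exact Or.inr ⟨_, memB (⟨_, cyclicSucc_lt hr⟩, ⟨j, hj⟩) h,
          generalizedPetersen_adj_inner (by omega) hkn (index_cyclicSucc_row hr hj)⟩
      · refine Or.inr ⟨_, memB (⟨_, cyclicPred_lt hr⟩, ⟨j, hj⟩) h,
          (generalizedPetersen_adj_inner (by omega) hkn ?_).symm⟩
        have := index_cyclicSucc_row (cyclicPred_lt hr) hj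
        rwa [cyclicSucc_cyclicPred hr] at this
  have hcard : S.card = ∑ r ∈ Finset.range c, ∑ j ∈ Finset.range k, labelWeight (w r j) := by
    have hbit : ∀ a : ℕ, labelWeight a =
        (if SelectsOuter a then 1 else 0) + (if SelectsInner a then 1 else 0) := by
      intro a
      unfold labelWeight SelectsOuter SelectsInner
      split_ifs <;> omega
    rw [Finset.card_disjSum, Finset.card_map, Finset.card_map, Finset.card_filter,
      Finset.card_filter, ← Finset.sum_add_distrib, Fintype.sum_prod_type, Finset.sum_range]
    refine Finset.sum_congr rfl fun r _ => ?_
    rw [Finset.sum_range]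
    exact Finset.sum_congr rfl fun j _ => (hbit _).symm
  exact Nat.sInf_le ⟨S, hS, hcard⟩

/-! ### Repeating rows and columns. -/

/-- The position in a table that is read at position `i` after its first four entries have been
repeated `s` times: `0, 1, 2, 3, …, 0, 1, 2, 3, 4, 5, …`. -/
def pumpIndex (s i : ℕ) : ℕ := if i < 4 * s then i % 4 else i + 4 - 4 * s

/-- Every position together with its cyclic neighbours looks like a position after at most two
repetitions. -/
theorem exists_pumpIndex_min (m s : ℕ) {i : ℕ} (hi : i < m + 4 * s) :
    ∃ i' < m + 4 * min s 2,
      pumpIndex (min s 2) i' = pumpIndex s i ∧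
      pumpIndex (min s 2) (cyclicSucc (m + 4 * min s 2) i') =
        pumpIndex s (cyclicSucc (m + 4 * s) i) ∧
      pumpIndex (min s 2) (cyclicPred (m + 4 * min s 2) i') =
        pumpIndex s (cyclicPred (m + 4 * s) i) ∧
      (i' + 1 < m + 4 * min s 2 ↔ i + 1 < m + 4 * s) ∧ (i' = 0 ↔ i = 0) := by
  rcases Nat.lt_or_ge s 2 with hs | hs
  · rw [min_eq_left hs.le]
    exact ⟨i, hi, rfl, rfl, rfl, Iff.rfl, Iff.rfl⟩
  rw [min_eq_right hs]
  -- From the last repeated entry onwards, distances to the end are kept. Earlier positions move to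
  -- the first copy, except that a later start of a copy goes to 4: its predecessor is the end of a
  -- copy, whereas that of 0 is the end of the whole range.
  obtain ⟨i', h⟩ : ∃ i', (4 * s ≤ i + 1 ∧ i' + 4 * s = i + 8) ∨ (i + 1 < 4 * s ∧
      (i = 0 ∧ i' = 0 ∨ 0 < i ∧ i % 4 = 0 ∧ i' = 4 ∨ 0 < i % 4 ∧ i' = i % 4)) := by
    rcases Nat.lt_or_ge (i + 1) (4 * s) with h | h
    · rcases Nat.eq_zero_or_pos i with h0 | h0
      · exact ⟨0, by omega⟩
      · rcases Nat.eq_zero_or_pos (i % 4) with h4 | h4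
        · exact ⟨4, by omega⟩
        · exact ⟨i % 4, by omega⟩
    · exact ⟨i + 8 - 4 * s, by omega⟩
  refine ⟨i', by omega, ?_, ?_, ?_, by omega, by omega⟩
  · unfold pumpIndex
    split_ifs <;> omega
  · unfold pumpIndex cyclicSucc
    split_ifs <;> omega
  · unfold pumpIndex cyclicPred
    split_ifs <;> omega

/-- A labelling with repeated rows and columns covers if it does so with each number of
repetitions capped at two. -/
theorem CoversArray.pump {m l s t : ℕ} {w : ℕ → ℕ → ℕ}
    (h : CoversArray (m + 4 * min s 2) (l + 4 * min t 2)
      fun r j => w (pumpIndex (min s 2) r) (pumpIndex (min t 2) j)) :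
    CoversArray (m + 4 * s) (l + 4 * t) fun r j => w (pumpIndex s r) (pumpIndex t j) := by
  intro r hr j hj
  obtain ⟨r', hr', er, ers, erp, -, -⟩ := exists_pumpIndex_min m s hr
  obtain ⟨j', hj', ej, ejs, ejp, hjs, hjp⟩ := exists_pumpIndex_min l t hj
  have key := h r' hr' j' hj'
  -- The row change on the outer cycle depends on `j` only through `j + 1 < k` and `j = 0`, which
  -- the reduction preserves.
  simp only [apply_ite (pumpIndex (min s 2)), er, ers, erp, ej, ejs, ejp, hjs, hjp] at key
  simpa only [apply_ite (pumpIndex s)] using key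

/-- The first four entries are read once per repetition and the remaining `m` once; applied to
columns and then rows, this cuts the weight into four blocks. -/
theorem sum_pumpIndex (m s : ℕ) (g : ℕ → ℕ) :
    ∑ i ∈ Finset.range (m + 4 * s), g (pumpIndex s i) =
      s * ∑ i ∈ Finset.range 4, g i + ∑ i ∈ Finset.range m, g (i + 4) := by
  have hloop : ∀ s, ∑ i ∈ Finset.range (4 * s), g (i % 4) = s * ∑ i ∈ Finset.range 4, g i := by
    intro s
    induction s with
    | zero => simp
    | succ s ih =>
      rw [Nat.mul_succ, Finset.sum_range_add _ (4 * s), ih, add_one_mul s]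
      refine congrArg _ (Finset.sum_congr rfl fun i hi => ?_)
      rw [Nat.mul_add_mod, Nat.mod_eq_of_lt (Finset.mem_range.1 hi)]
  rw [add_comm m, Finset.sum_range_add, ← hloop]
  refine congrArg₂ _ (Finset.sum_congr rfl fun i hi => ?_) (Finset.sum_congr rfl fun i _ => ?_)
  · rw [pumpIndex, if_pos (Finset.mem_range.1 hi)]
  · rw [pumpIndex, if_neg (by omega)]
    congr 1
    omega

/-! ### Tables and their weights. -/

/-- The entry of a table given as a list of rows. -/
def tableEntry (T : List (List ℕ)) (r j : ℕ) : ℕ := (T.getD r []).getD j 0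

/-- The total weight of the `m × l` block of a table whose upper left corner is `(a, b)`. -/
def blockWeight (T : List (List ℕ)) (a b m l : ℕ) : ℕ :=
  ∑ r ∈ Finset.range m, ∑ j ∈ Finset.range l, labelWeight (tableEntry T (r + a) (j + b))

/-- The bound given by a table with `m + 4` rows and `l + 4` columns whose first four rows and
columns are repeated. -/
theorem dominationNumber_le_of_table (T : List (List ℕ)) {m l s t : ℕ}
    (hc : 2 ≤ m + 4 * s) (hk : 2 ≤ l + 4 * t)
    (h : CoversArray (m + 4 * min s 2) (l + 4 * min t 2)
      fun r j => tableEntry T (pumpIndex (min s 2) r) (pumpIndex (min t 2) j)) :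
    dominationNumber (generalizedPetersen ((m + 4 * s) * (l + 4 * t)) (l + 4 * t)) ≤
      s * (t * blockWeight T 0 0 4 4 + blockWeight T 0 4 4 l) +
        (t * blockWeight T 4 0 m 4 + blockWeight T 4 4 m l) := by
  refine (dominationNumber_le_of_coversArray hc hk h.pump).trans (le_of_eq ?_)
  rw [Finset.sum_congr rfl fun r _ =>
    sum_pumpIndex l t fun j => labelWeight (tableEntry T (pumpIndex s r) j)]
  rw [sum_pumpIndex m s fun r => t * ∑ i ∈ Finset.range 4, labelWeight (tableEntry T r i) +
    ∑ i ∈ Finset.range l, labelWeight (tableEntry T r (i + 4))]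
  simp only [blockWeight, Finset.sum_add_distrib, Finset.mul_sum, add_zero]

/-- The table covers with at most two repetitions of its first four rows and of its first four
columns, and hence, by `CoversArray.pump`, with any number of repetitions. -/
def IsPumpable (T : List (List ℕ)) (m l : ℕ) : Prop :=
  ∀ s < 3, ∀ t < 3, CoversArray (m + 4 * s) (l + 4 * t)
    fun r j => tableEntry T (pumpIndex s r) (pumpIndex t j)

instance (T : List (List ℕ)) (m l : ℕ) : Decidable (IsPumpable T m l) := by
  unfold IsPumpable
  infer_instance

theorem IsPumpable.dominationNumber_le {T : List (List ℕ)} {m l : ℕ} (h : IsPumpable T m l)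
    (hm : 2 ≤ m) (hl : 2 ≤ l) (s t : ℕ) :
    dominationNumber (generalizedPetersen ((m + 4 * s) * (l + 4 * t)) (l + 4 * t)) ≤
      s * (t * blockWeight T 0 0 4 4 + blockWeight T 0 4 4 l) +
        (t * blockWeight T 4 0 m 4 + blockWeight T 4 4 m l) :=
  dominationNumber_le_of_table T (by omega) (by omega) (h _ (by omega) _ (by omega))

/-! ### The explicit tables and their verification. -/

/-- A table with `m + 4` rows and `l + 4` columns, for `3 ≤ m ≤ 6` and `3 ≤ l ≤ 6`, whose first
four rows and first four columns may be repeated or left out. -/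
def dominatingTable : ℕ → ℕ → List (List ℕ)
  | 3, 3 =>
    [[0, 2, 0, 1, 0, 2, 0],
     [1, 0, 2, 0, 1, 0, 2],
     [0, 1, 0, 2, 0, 1, 0],
     [2, 0, 1, 0, 2, 0, 1],
     [0, 2, 0, 1, 0, 2, 0],
     [1, 0, 2, 0, 1, 0, 2],
     [2, 1, 0, 2, 2, 0, 1]]
  | 3, 4 =>
    [[0, 2, 0, 1, 0, 0, 1, 0],
     [2, 0, 1, 0, 2, 1, 0, 2],
     [0, 1, 0, 2, 1, 0, 2, 0],
     [1, 0, 2, 0, 1, 2, 0, 1],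
     [0, 2, 0, 1, 0, 0, 1, 0],
     [2, 0, 1, 0, 2, 0, 1, 2],
     [0, 1, 2, 2, 0, 3, 1, 1]]
  | 3, 5 =>
    [[1, 0, 2, 0, 1, 0, 2, 0, 1],
     [0, 2, 0, 1, 0, 2, 0, 1, 0],
     [2, 0, 1, 0, 2, 0, 1, 0, 2],
     [0, 1, 0, 2, 0, 1, 0, 2, 0],
     [1, 0, 2, 0, 1, 0, 2, 0, 1],
     [0, 2, 0, 1, 2, 2, 0, 1, 0],
     [2, 1, 0, 2, 0, 1, 0, 2, 2]]
  | 3, 6 =>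
    [[0, 1, 0, 2, 0, 1, 0, 2, 1, 0],
     [2, 0, 1, 0, 2, 0, 1, 0, 0, 1],
     [0, 2, 0, 1, 0, 2, 0, 1, 2, 0],
     [1, 0, 2, 0, 1, 0, 2, 1, 0, 2],
     [0, 1, 0, 2, 0, 1, 0, 2, 1, 0],
     [2, 0, 1, 0, 2, 2, 0, 1, 0, 1],
     [0, 2, 2, 1, 0, 0, 3, 0, 2, 2]]
  | 4, 3 =>
    [[0, 2, 0, 1, 0, 2, 0],
     [1, 0, 2, 0, 1, 0, 2],
     [0, 1, 0, 2, 0, 1, 0],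
     [2, 0, 1, 0, 2, 0, 1],
     [0, 2, 0, 1, 0, 2, 0],
     [1, 0, 2, 0, 1, 0, 2],
     [0, 1, 0, 2, 0, 1, 0],
     [2, 0, 1, 0, 2, 0, 1]]
  | 4, 4 =>
    [[2, 0, 1, 0, 2, 0, 1, 2],
     [0, 1, 0, 2, 0, 1, 0, 0],
     [1, 0, 2, 0, 1, 0, 2, 1],
     [0, 2, 0, 1, 0, 2, 0, 1],
     [2, 0, 1, 0, 2, 0, 1, 2],
     [0, 1, 0, 2, 0, 1, 0, 0],
     [1, 0, 2, 0, 1, 0, 2, 1],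
     [0, 2, 0, 1, 0, 2, 0, 1]]
  | 4, 5 =>
    [[0, 2, 0, 1, 0, 2, 0, 1, 0],
     [2, 0, 1, 0, 2, 0, 1, 0, 2],
     [0, 1, 0, 2, 0, 1, 0, 2, 0],
     [1, 0, 2, 0, 1, 0, 2, 0, 1],
     [0, 2, 0, 1, 0, 2, 0, 1, 0],
     [2, 0, 1, 0, 2, 0, 1, 0, 2],
     [0, 1, 0, 2, 0, 1, 0, 2, 0],
     [1, 0, 2, 0, 1, 0, 2, 0, 1]]
  | 4, 6 =>
    [[1, 0, 2, 0, 1, 0, 0, 1, 0, 2],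
     [0, 1, 0, 2, 0, 1, 2, 0, 1, 0],
     [2, 0, 1, 0, 2, 1, 0, 2, 0, 1],
     [0, 2, 0, 1, 0, 2, 1, 0, 2, 0],
     [1, 0, 2, 0, 1, 0, 2, 1, 0, 2],
     [0, 1, 0, 2, 0, 1, 0, 0, 1, 0],
     [2, 0, 1, 0, 2, 0, 1, 2, 0, 1],
     [0, 2, 0, 1, 0, 2, 1, 0, 2, 0]]
  | 5, 3 =>
    [[0, 2, 0, 1, 0, 2, 0],
     [1, 0, 2, 0, 1, 0, 2],
     [0, 1, 0, 2, 0, 1, 0],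
     [2, 0, 1, 0, 2, 0, 1],
     [0, 2, 0, 3, 0, 2, 1],
     [1, 0, 2, 0, 1, 2, 0],
     [1, 1, 0, 0, 1, 0, 2],
     [0, 1, 0, 2, 0, 1, 0],
     [2, 0, 3, 0, 2, 0, 1]]
  | 5, 4 =>
    [[0, 2, 0, 1, 0, 2, 1, 0],
     [2, 0, 1, 0, 2, 0, 1, 2],
     [0, 1, 0, 2, 0, 1, 0, 0],
     [1, 0, 2, 0, 1, 0, 2, 1],
     [1, 2, 2, 0, 1, 2, 0, 1],
     [0, 2, 0, 3, 0, 0, 1, 0],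
     [2, 0, 1, 0, 2, 1, 1, 2],
     [0, 1, 0, 2, 0, 1, 0, 0],
     [1, 0, 2, 0, 1, 0, 2, 1]]
  | 5, 5 =>
    [[1, 0, 2, 0, 1, 0, 2, 0, 1],
     [0, 2, 0, 1, 0, 2, 0, 1, 0],
     [2, 0, 1, 0, 2, 0, 1, 0, 2],
     [0, 1, 0, 2, 0, 1, 0, 2, 0],
     [1, 0, 2, 0, 1, 0, 2, 0, 1],
     [0, 2, 0, 3, 0, 2, 0, 1, 0],
     [2, 2, 1, 0, 2, 0, 1, 0, 2],
     [2, 0, 1, 0, 0, 1, 0, 2, 2],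
     [0, 1, 0, 2, 2, 2, 2, 2, 0]]
  | 5, 6 =>
    [[1, 0, 2, 0, 1, 0, 0, 1, 0, 2],
     [0, 1, 0, 2, 0, 1, 2, 0, 1, 0],
     [2, 0, 1, 0, 2, 1, 0, 2, 0, 1],
     [0, 2, 0, 1, 0, 2, 1, 0, 2, 0],
     [1, 0, 2, 2, 1, 0, 0, 1, 0, 2],
     [1, 1, 0, 0, 1, 0, 2, 0, 1, 0],
     [0, 1, 1, 0, 0, 3, 0, 2, 1, 1],
     [2, 0, 1, 2, 2, 0, 1, 2, 0, 1],
     [0, 2, 0, 1, 0, 2, 1, 0, 2, 0]]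
  | 6, 3 =>
    [[0, 1, 0, 2, 0, 1, 0],
     [2, 0, 1, 0, 2, 0, 1],
     [0, 2, 0, 1, 0, 2, 0],
     [1, 0, 2, 0, 1, 0, 2],
     [1, 0, 2, 2, 2, 0, 1],
     [0, 2, 0, 1, 0, 2, 2],
     [2, 0, 1, 0, 0, 1, 0],
     [2, 0, 1, 2, 2, 0, 1],
     [0, 2, 0, 1, 0, 2, 0],
     [1, 0, 2, 0, 1, 0, 2]]
  | 6, 4 =>
    [[2, 0, 1, 0, 0, 1, 0, 2],
     [0, 1, 0, 2, 1, 0, 2, 0],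
     [1, 0, 2, 0, 1, 2, 0, 1],
     [0, 2, 0, 1, 2, 0, 1, 0],
     [2, 0, 1, 0, 0, 1, 0, 2],
     [0, 1, 0, 2, 2, 2, 2, 0],
     [1, 2, 2, 0, 1, 0, 0, 1],
     [1, 0, 0, 1, 1, 0, 0, 1],
     [1, 0, 0, 1, 0, 2, 2, 1],
     [0, 2, 2, 1, 2, 0, 1, 0]]
  | 6, 5 =>
    [[2, 0, 1, 0, 2, 0, 1, 0, 2],
     [0, 1, 0, 2, 0, 1, 0, 2, 0],
     [1, 0, 2, 0, 1, 0, 2, 0, 1],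
     [0, 2, 0, 1, 0, 2, 0, 1, 0],
     [2, 0, 1, 0, 2, 0, 1, 0, 2],
     [0, 1, 0, 2, 0, 3, 0, 2, 0],
     [3, 2, 2, 0, 1, 0, 2, 0, 3],
     [0, 1, 0, 2, 1, 1, 0, 2, 0],
     [1, 0, 2, 0, 1, 0, 2, 0, 1],
     [0, 2, 0, 1, 0, 2, 0, 1, 0]]
  | 6, 6 =>
    [[1, 0, 2, 0, 1, 2, 0, 1, 0, 2],
     [0, 1, 0, 2, 1, 0, 2, 0, 1, 0],
     [2, 0, 1, 0, 0, 1, 0, 2, 0, 1],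
     [0, 2, 0, 1, 2, 0, 1, 0, 2, 0],
     [1, 0, 2, 0, 1, 2, 0, 1, 0, 2],
     [1, 1, 0, 2, 1, 2, 2, 1, 0, 0],
     [1, 0, 2, 0, 1, 0, 0, 1, 2, 1],
     [0, 2, 0, 3, 0, 0, 1, 0, 0, 1],
     [2, 0, 1, 0, 2, 2, 1, 2, 0, 1],
     [0, 2, 0, 1, 0, 0, 1, 0, 2, 0]]
  | _, _ => []

/-- A table for `k = 4` whose first four rows may be repeated or left out. -/
def dominatingTableFour : List (List ℕ) :=
    [[1, 0, 2, 2],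
     [0, 3, 0, 2],
     [2, 0, 1, 0],
     [0, 1, 0, 0],
     [1, 2, 2, 2],
     [2, 0, 1, 0],
     [0, 1, 0, 0]]

/-- A table for `k = 8` whose first four rows may be repeated or left out. -/
def dominatingTableEight : List (List ℕ) :=
    [[2, 0, 1, 0, 2, 0, 1, 0],
     [0, 1, 0, 2, 0, 1, 0, 2],
     [1, 0, 2, 0, 1, 0, 2, 0],
     [1, 2, 0, 1, 0, 2, 0, 1],
     [1, 0, 0, 1, 2, 0, 1, 0],
     [1, 0, 2, 1, 0, 0, 1, 2],
     [1, 2, 0, 1, 0, 2, 1, 0]]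

/-- A finite computation: sixteen tables, each with nine pairs of repetition counts. -/
theorem isPumpable_dominatingTable :
    ∀ m < 7, ∀ l < 7, 3 ≤ m → 3 ≤ l → IsPumpable (dominatingTable m l) m l := by
  decide +kernel

theorem coversArray_dominatingTableFour : ∀ s < 3, CoversArray (3 + 4 * s) (0 + 4 * 1)
    fun r j => tableEntry dominatingTableFour (pumpIndex s r) (pumpIndex 1 j) := by
  decide +kernel

theorem coversArray_dominatingTableEight : ∀ s < 3, CoversArray (3 + 4 * s) (4 + 4 * 1)
    fun r j => tableEntry dominatingTableEight (pumpIndex s r) (pumpIndex 1 j) := by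
  decide +kernel

/-- The weights of the four blocks into which a table is cut after its first four rows and its
first four columns. -/
def blockWeights (T : List (List ℕ)) (m l : ℕ) : ℕ × ℕ × ℕ × ℕ :=
  (blockWeight T 0 0 4 4, blockWeight T 0 4 4 l, blockWeight T 4 0 m 4, blockWeight T 4 4 m l)

theorem dominationNumber_le_of_blockWeights (m l d a b e s t : ℕ)
    (hw : (m < 7 ∧ l < 7 ∧ 3 ≤ m ∧ 3 ≤ l) ∧
      blockWeights (dominatingTable m l) m l = (d, a, b, e)) :
    (dominationNumber (generalizedPetersen ((m + 4 * s) * (l + 4 * t)) (l + 4 * t)) : ℚ) ≤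
      s * (t * d + a) + (t * b + e) := by
  obtain ⟨⟨hm, hl, hm', hl'⟩, hw⟩ := hw
  have h := (isPumpable_dominatingTable m hm l hl hm' hl').dominationNumber_le
    (by omega) (by omega) s t
  simp only [blockWeights, Prod.mk.injEq] at hw
  obtain ⟨rfl, rfl, rfl, rfl⟩ := hw
  exact_mod_cast h

/-- The general table for these residues would give `9s + 8`, one too many. Here `l = 0` and `t =
1`, so the columns are read unchanged. -/
theorem dominationNumber_le_four (s : ℕ) :
    (dominationNumber (generalizedPetersen ((3 + 4 * s) * 4) 4) : ℚ) ≤ s * 9 + 7 := by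
  have h := dominationNumber_le_of_table dominatingTableFour (m := 3) (l := 0) (s := s) (t := 1)
    (by omega) (by omega) (coversArray_dominatingTableFour _ (by omega))
  have hw : blockWeights dominatingTableFour 3 0 = (9, 0, 7, 0) := by decide +kernel
  simp only [blockWeights, Prod.mk.injEq] at hw
  obtain ⟨h1, h2, h3, h4⟩ := hw
  rw [h1, h2, h3, h4] at h
  exact_mod_cast h

/-- Again one better than the general table, which gives `17s + 15`; `pumpIndex 1` is the identity.
-/
theorem dominationNumber_le_eight (s : ℕ) :
    (dominationNumber (generalizedPetersen ((3 + 4 * s) * 8) 8) : ℚ) ≤ s * 17 + 14 := by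
  have h := dominationNumber_le_of_table dominatingTableEight (m := 3) (l := 4) (s := s) (t := 1)
    (by omega) (by omega) (coversArray_dominatingTableEight _ (by omega))
  have hw : blockWeights dominatingTableEight 3 4 = (9, 8, 8, 6) := by decide +kernel
  simp only [blockWeights, Prod.mk.injEq] at hw
  obtain ⟨h1, h2, h3, h4⟩ := hw
  rw [h1, h2, h3, h4] at h
  exact_mod_cast h

/-! ### Comparison with the stated bounds. -/

theorem petersenAlpha_odd {c k : ℕ} (h : k % 2 = 1) : petersenAlpha c k = 0 := if_pos h

theorem petersenAlpha_even {c k : ℕ} (h : k % 2 = 0) : petersenAlpha c k = c / 4 :=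
  if_neg (by omega)

theorem add_le_floor_add_floor {c k a b : ℕ} (ha : 2 * a ≤ c * k) (hb : 4 * b ≤ k) :
    (a + b : ℚ) ≤ (⌊(c : ℚ) * k / 2⌋ : ℚ) + (⌊(k : ℚ) / 4⌋ : ℚ) := by
  qify at ha hb
  have h2 : (a : ℤ) ≤ ⌊(c : ℚ) * k / 2⌋ := Int.le_floor.2 (by push_cast; linarith)
  have h4 : (b : ℤ) ≤ ⌊(k : ℚ) / 4⌋ := Int.le_floor.2 (by push_cast; linarith)
  exact_mod_cast add_le_add h2 h4

/-- The offsets 3 to 6, instead of 0 to 3, allow `t = 0` for the smallest values of `k`. -/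
theorem exists_eq_add_four_mul {k : ℕ} (hk : 3 ≤ k) :
    ∃ t, k = 3 + 4 * t ∨ k = 4 + 4 * t ∨ k = 5 + 4 * t ∨ k = 6 + 4 * t :=
  ⟨(k - 3) / 4, by omega⟩

theorem theorem2p1 (c k : ℕ) (hc : 3 ≤ c) (hk : 3 ≤ k) :
    (c % 4 = 0 →
      (dominationNumber (generalizedPetersen (c * k) k) : ℚ) ≤
        (c : ℚ) * k / 2 + petersenAlpha c k) ∧
    ((c % 4 = 1 ∨ c % 4 = 2) → k % 2 = 0 →
      (dominationNumber (generalizedPetersen (c * k) k) : ℚ) ≤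
        (c : ℚ) * k / 2 + (k : ℚ) / 2 - 1 + petersenAlpha c k) ∧
    (c % 4 = 1 → k % 2 = 1 →
      (dominationNumber (generalizedPetersen (c * k) k) : ℚ) ≤
        ((c : ℚ) * k - 1) / 2 + ((k : ℚ) + 1) / 2 + petersenAlpha c k) ∧
    (c % 4 = 2 → k % 4 = 1 →
      (dominationNumber (generalizedPetersen (c * k) k) : ℚ) ≤
        (c : ℚ) * k / 2 + ((k : ℚ) + 1) / 2 + petersenAlpha c k) ∧
    (c % 4 = 2 → k % 4 = 3 →
      (dominationNumber (generalizedPetersen (c * k) k) : ℚ) ≤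
        (c : ℚ) * k / 2 + ((k : ℚ) - 1) / 2 + petersenAlpha c k) ∧
    (c % 4 = 3 → k ≠ 4 → k ≠ 8 →
      (dominationNumber (generalizedPetersen (c * k) k) : ℚ) ≤
        (⌊(c : ℚ) * k / 2⌋ : ℚ) + (⌊(k : ℚ) / 4⌋ : ℚ) + 1 + petersenAlpha c k) ∧
    (c % 4 = 3 → (k = 4 ∨ k = 8) →
      (dominationNumber (generalizedPetersen (c * k) k) : ℚ) ≤
        (c : ℚ) * k / 2 + (k : ℚ) / 4 + petersenAlpha c k) := by
  obtain ⟨t, ht⟩ := exists_eq_add_four_mul hk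
  refine ⟨fun h0 => ?_, fun h12 hk2 => ?_, fun h1 hk2 => ?_, fun h2 hk4 => ?_, fun h2 hk4 => ?_,
    fun h3 _ _ => ?_, fun h3 hk48 => ?_⟩
  · obtain ⟨s, rfl⟩ : ∃ s, c = 4 + 4 * s := ⟨(c - 4) / 4, by omega⟩
    rcases ht with rfl | rfl | rfl | rfl
    -- The four block weights sum to `(s + 1)(8t + 6)`, exactly `ck/2`.
    · have h := dominationNumber_le_of_blockWeights 4 3 8 6 8 6 s t (by decide +kernel)
      rw [petersenAlpha_odd (by omega)]
      push_cast at h ⊢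
      linarith
    · have h := dominationNumber_le_of_blockWeights 4 4 8 9 8 9 s t (by decide +kernel)
      rw [petersenAlpha_even (by omega), show (4 + 4 * s) / 4 = s + 1 by omega]
      push_cast at h ⊢
      linarith
    · have h := dominationNumber_le_of_blockWeights 4 5 8 10 8 10 s t (by decide +kernel)
      rw [petersenAlpha_odd (by omega)]
      push_cast at h ⊢
      linarith
    · have h := dominationNumber_le_of_blockWeights 4 6 8 13 8 13 s t (by decide +kernel)
      rw [petersenAlpha_even (by omega), show (4 + 4 * s) / 4 = s + 1 by omega]
      push_cast at h ⊢
      linarith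
  · rcases h12 with h1 | h2
    · obtain ⟨s, rfl⟩ : ∃ s, c = 5 + 4 * s := ⟨(c - 5) / 4, by omega⟩
      rcases ht with rfl | rfl | rfl | rfl
      · omega
      -- Half the area of the blocks would be 8, 8, 10, 10: the excess in 9 pays for
      -- `petersenAlpha`, that in 12 for `k/2`.
      · have h := dominationNumber_le_of_blockWeights 5 4 8 9 12 12 s t (by decide +kernel)
        rw [petersenAlpha_even (by omega), show (5 + 4 * s) / 4 = s + 1 by omega]
        push_cast at h ⊢
        linarith
      · omega
      · have h := dominationNumber_le_of_blockWeights 5 6 8 13 12 18 s t (by decide +kernel)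
        rw [petersenAlpha_even (by omega), show (5 + 4 * s) / 4 = s + 1 by omega]
        push_cast at h ⊢
        linarith
    · obtain ⟨s, rfl⟩ : ∃ s, c = 6 + 4 * s := ⟨(c - 6) / 4, by omega⟩
      rcases ht with rfl | rfl | rfl | rfl
      · omega
      · have h := dominationNumber_le_of_blockWeights 6 4 8 9 14 14 s t (by decide +kernel)
        rw [petersenAlpha_even (by omega), show (6 + 4 * s) / 4 = s + 1 by omega]
        push_cast at h ⊢
        linarith
      · omega
      · have h := dominationNumber_le_of_blockWeights 6 6 8 13 14 21 s t (by decide +kernel)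
        rw [petersenAlpha_even (by omega), show (6 + 4 * s) / 4 = s + 1 by omega]
        push_cast at h ⊢
        linarith
  · obtain ⟨s, rfl⟩ : ∃ s, c = 5 + 4 * s := ⟨(c - 5) / 4, by omega⟩
    rcases ht with rfl | rfl | rfl | rfl
    · have h := dominationNumber_le_of_blockWeights 5 3 8 6 12 9 s t (by decide +kernel)
      rw [petersenAlpha_odd (by omega)]
      push_cast at h ⊢
      linarith
    · omega
    · have h := dominationNumber_le_of_blockWeights 5 5 8 10 12 15 s t (by decide +kernel)
      rw [petersenAlpha_odd (by omega)]
      push_cast at h ⊢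
      linarith
    · omega
  · obtain ⟨s, rfl⟩ : ∃ s, c = 6 + 4 * s := ⟨(c - 6) / 4, by omega⟩
    rcases ht with rfl | rfl | rfl | rfl
    · omega
    · omega
    · have h := dominationNumber_le_of_blockWeights 6 5 8 10 14 18 s t (by decide +kernel)
      rw [petersenAlpha_odd (by omega)]
      push_cast at h ⊢
      linarith
    · omega
  · obtain ⟨s, rfl⟩ : ∃ s, c = 6 + 4 * s := ⟨(c - 6) / 4, by omega⟩
    rcases ht with rfl | rfl | rfl | rfl
    · have h := dominationNumber_le_of_blockWeights 6 3 8 6 14 10 s t (by decide +kernel)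
      rw [petersenAlpha_odd (by omega)]
      push_cast at h ⊢
      linarith
    · omega
    · omega
    · omega
  · obtain ⟨s, rfl⟩ : ∃ s, c = 3 + 4 * s := ⟨(c - 3) / 4, by omega⟩
    rcases ht with rfl | rfl | rfl | rfl
    · have h := dominationNumber_le_of_blockWeights 3 3 8 6 7 5 s t (by decide +kernel)
      rw [petersenAlpha_odd (by omega)]
      -- Here and below, `a` and `b` are the exact values of `⌊ck/2⌋` and `⌊k/4⌋`.
      have hf := add_le_floor_add_floor (c := 3 + 4 * s) (k := 3 + 4 * t)
        (a := 8 * (s * t) + 6 * s + 6 * t + 4) (b := t) (by linarith) (by omega)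
      push_cast at h hf ⊢
      linarith
    · have h := dominationNumber_le_of_blockWeights 3 4 8 9 7 8 s t (by decide +kernel)
      rw [petersenAlpha_even (by omega), show (3 + 4 * s) / 4 = s by omega]
      have hf := add_le_floor_add_floor (c := 3 + 4 * s) (k := 4 + 4 * t)
        (a := 8 * (s * t) + 8 * s + 6 * t + 6) (b := t + 1) (by linarith) (by omega)
      push_cast at h hf ⊢
      linarith
    · have h := dominationNumber_le_of_blockWeights 3 5 8 10 7 9 s t (by decide +kernel)
      rw [petersenAlpha_odd (by omega)]
      have hf := add_le_floor_add_floor (c := 3 + 4 * s) (k := 5 + 4 * t)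
        (a := 8 * (s * t) + 10 * s + 6 * t + 7) (b := t + 1) (by linarith) (by omega)
      push_cast at h hf ⊢
      linarith
    · have h := dominationNumber_le_of_blockWeights 3 6 8 13 7 11 s t (by decide +kernel)
      rw [petersenAlpha_even (by omega), show (3 + 4 * s) / 4 = s by omega]
      have hf := add_le_floor_add_floor (c := 3 + 4 * s) (k := 6 + 4 * t)
        (a := 8 * (s * t) + 12 * s + 6 * t + 9) (b := t + 1) (by linarith) (by omega)
      push_cast at h hf ⊢
      linarith
  · obtain ⟨s, rfl⟩ : ∃ s, c = 3 + 4 * s := ⟨(c - 3) / 4, by omega⟩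
    rcases hk48 with rfl | rfl
    · have h := dominationNumber_le_four s
      rw [petersenAlpha_even (by omega), show (3 + 4 * s) / 4 = s by omega]
      push_cast at h ⊢
      linarith
    · have h := dominationNumber_le_eight s
      rw [petersenAlpha_even (by omega), show (3 + 4 * s) / 4 = s by omega]
      push_cast at h ⊢
      linarith
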